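/- Let $X$ and $Y$ be infinite Tychonoff spaces, and let $C_p(X\times Y)$ be the space of all real-valued continuous functions on $X\times Y$ with the topology of pointwise convergence. Then there is a linear subspace $F$ of $C_p(X\times Y)$ such that 1. $F$, with the topology induced from $C_p(X\times Y)$, is complemented in $C_p(X\times Y)$, i.e. it is the range of a continuous linear projection $C_p(X\times Y)\to F$; and 2. the strong dual $F'_\beta$ of $F$ (the space of continuous linear functionals on $F$ with the topology of uniform convergence on the bounded subsets of $F$) is isomorphic, as a topological vector space, to $\varphi$, the $\aleph_0$-dimensional real vector space with the finest locally convex topology. -/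

import Mathlib

/-- `Cp X`: the space of real-valued continuous functions on `X` with the topology of pointwise
convergence, realised as a linear subspace of the product space `X → ℝ`, from which it inherits
its vector space structure and its topology. -/
def Cp (X : Type*) [TopologicalSpace X] : Submodule ℝ (X → ℝ) where
  carrier := {f | Continuous f}
  add_mem' hf hg := Continuous.add hf hg
  zero_mem' := continuous_const
  smul_mem' c _ hf := Continuous.const_smul hf c

/-- The finest locally convex vector space topology on a real vector space `E`. (In the lattice of
topologies the finer one is the smaller one; the infimum is again such a topology, see below.) -/
abbrev finestLocallyConvexTopology (E : Type*) [AddCommGroup E] [Module ℝ E] : TopologicalSpace E :=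
  sInf {t | @IsTopologicalAddGroup E t _ ∧ @ContinuousSMul ℝ E _ _ t ∧
    @LocallyConvexSpace ℝ E _ _ _ _ t}

/-- The underlying vector space of `φ`: the real vector space of dimension `ℵ₀`. -/
def PhiSpace : Type := ℕ →₀ ℝ

noncomputable instance PhiSpace.instAddCommGroup : AddCommGroup PhiSpace := inferInstanceAs (AddCommGroup (ℕ →₀ ℝ))

noncomputable instance PhiSpace.instModule : Module ℝ PhiSpace := inferInstanceAs (Module ℝ (ℕ →₀ ℝ))

/-- `φ` carries the finest locally convex topology. -/
noncomputable instance PhiSpace.instTopologicalSpace : TopologicalSpace PhiSpace := finestLocallyConvexTopology PhiSpace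

instance PhiSpace.instIsTopologicalAddGroup : IsTopologicalAddGroup PhiSpace := topologicalAddGroup_sInf fun _ ht => ht.1

instance PhiSpace.instContinuousSMul : ContinuousSMul ℝ PhiSpace := continuousSMul_sInf fun _ ht => ht.2.1

instance PhiSpace.instLocallyConvexSpace : LocallyConvexSpace ℝ PhiSpace := LocallyConvexSpace.sInf fun _ ht => ht.2.2

/-- `F` is `φ`-dual: its strong dual (the topological dual with the topology of uniform
convergence on bounded sets, which is Mathlib's topology on `StrongDual`) is isomorphic to `φ`
as a topological vector space. -/
def IsPhiDual (F : Type*) [AddCommGroup F] [Module ℝ F] [TopologicalSpace F] : Prop :=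
  Nonempty (StrongDual ℝ F ≃L[ℝ] PhiSpace)

/-!
The space `Cp Z` has a complemented subspace with strong dual `φ` as soon
as there are a biorthogonal system of functionals `μ n` and functions `f n` in `Cp Z` for which
`P g = ∑ n, μ n g • f n` is a point-finite sum with continuous values
(`exists_closedComplemented_isPhiDual`). Then `P` is a continuous projection, and the topology of its
range is induced by the `μ n`. So the dual of the range is the span of the `μ n`, that is, `φ`
algebraically; and it is `φ` topologically since all the sets `{a n • f n}` are bounded in the range
and their polars are the boxes `{c | ∀ n, |a n * c n| < 1}`, which are arbitrarily small in the finest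
locally convex topology (`isPhiDual_of_biorthogonal`).

If `Z = X × Y` carries an unbounded continuous function, point evaluations and a locally finite
sequence of bumps give such a system
(`exists_closedComplemented_isPhiDual_of_unbounded`); the range is `ℝ^ℕ`.

If `X × Y` is pseudocompact, `μ n` is a signed average over a grid: its points are `(x s, y j)` for
`s` a sign vector of length `n + 1` and `j ≤ n`, with the sign `s j` at `(x s, y j)`. By the
orthogonality of the Rademacher functions, the averages of a product of functions with values in
`[-1, 1]` are at most `1 / √(n + 1)` in absolute value. A continuous function `g` on `X × Y` has sections `g (·, y)`
that are totally bounded for uniform convergence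
(`exists_finset_abs_sub_le_of_pseudocompact`), so it is uniformly close to a finite sum of products,
and `μ n g → 0` (`tendsto_signedAverage`). If the grids have disjoint projections to `X`, there are
`f n` with values in `[-1, 1]` and disjoint supports that take the value `s j` at `(x s, y j)`;
then `∑ n, μ n g • f n` converges uniformly, and the range of the projection is a copy of `c₀` with
the topology of pointwise convergence.
-/

open Filter Topology Bornology

/-! ### Spaces whose strong dual is `φ` -/

theorem Convex.sum_smul_mem_of_sum_le_one {E ι : Type*} [AddCommGroup E] [Module ℝ E] {V : Set E}
    (hV : Convex ℝ V) (h0 : (0 : E) ∈ V) {t : Finset ι} {w : ι → ℝ} {z : ι → E}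
    (hw : ∀ i ∈ t, 0 ≤ w i) (hw1 : ∑ i ∈ t, w i ≤ 1) (hz : ∀ i ∈ t, z i ∈ V) :
    ∑ i ∈ t, w i • z i ∈ V := by
  -- The missing weight is put on the origin.
  have := hV.sum_mem (t := t.insertNone) (w := fun o => o.elim (1 - ∑ i ∈ t, w i) w)
    (z := fun o => o.elim 0 z) ?_ ?_ ?_
  · simpa [Finset.sum_insertNone] using this
  · rintro (_ | i) hi
    · simpa using hw1
    · exact hw i (by simpa using hi)
  · simp [Finset.sum_insertNone]
  · rintro (_ | i) hi
    · exact h0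
    · exact hz i (by simpa using hi)

section PhiDual

variable {F : Type*} [AddCommGroup F] [Module ℝ F] [TopologicalSpace F]

/-- A linear map from `φ` to a locally convex space is continuous. -/
theorem PhiSpace.continuous_linearMap {E : Type*} [AddCommGroup E] [Module ℝ E]
    [TopologicalSpace E] [IsTopologicalAddGroup E] [ContinuousSMul ℝ E] [LocallyConvexSpace ℝ E]
    (T : PhiSpace →ₗ[ℝ] E) : Continuous T := by
  rw [continuous_iff_le_induced]
  refine sInf_le ⟨topologicalAddGroup_induced T, continuousSMul_induced T, ?_⟩
  exact LocallyConvexSpace.induced T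

/-- The functionals `e n` that induce the topology of `F` span its dual. -/
theorem mem_span_of_isInducing {e : ℕ → StrongDual ℝ F} (he : IsInducing fun x n => e n x)
    (u : StrongDual ℝ F) : u ∈ Submodule.span ℝ (Set.range e) := by
  have h1 : (u : F →ₗ[ℝ] ℝ) ∈ Submodule.span ℝ (Set.range fun n => (e n : F →ₗ[ℝ] ℝ)) := by
    rw [LinearMap.mem_span_iff_continuous]
    refine continuous_iff_le_induced.2 (le_trans (le_of_eq ?_) u.continuous.le_induced)
    refine Eq.trans ?_ he.eq_induced.symm
    simp only [Pi.topologicalSpace, induced_iInf, induced_compose]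
    rfl
  have h2 : (Set.range fun n => (e n : F →ₗ[ℝ] ℝ)) =
      ContinuousLinearMap.coeLM ℝ '' Set.range e := by
    rw [← Set.range_comp]; rfl
  rw [h2, ← Submodule.map_span] at h1
  obtain ⟨v, hv, hvu⟩ := h1
  rwa [← ContinuousLinearMap.coe_injective hvu]

/-- In a space whose topology is induced by the functionals `e n`, scaling the vectors of a system
biorthogonal to `e` in an arbitrary way gives a bounded set: every `e m` vanishes on all of them
but one. -/
theorem isVonNBounded_range_smul_of_biorthogonal [ContinuousSMul ℝ F]
    {e : ℕ → StrongDual ℝ F} {b : ℕ → F}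
    (he : IsInducing fun x n => e n x) (hb : ∀ m n, e m (b n) = if m = n then 1 else 0)
    (a : ℕ → ℝ) : IsVonNBounded ℝ (Set.range fun n => a n • b n) := by
  refine isVonNBounded_of_smul_tendsto_zero (l := atTop)
    (ε := fun k : ℕ => (1 : ℝ) / ((k : ℝ) + 1)) (Eventually.of_forall fun k => by positivity) ?_
  intro x hx
  rw [he.tendsto_nhds_iff, tendsto_pi_nhds]
  intro m
  have hbd : ∀ k, |e m (x k)| ≤ |a m| := by
    intro k
    obtain ⟨n, hn⟩ := hx k
    rw [← hn, map_smul, hb, smul_eq_mul]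
    split_ifs with h
    · simp [h]
    · simp
  simp only [Function.comp_def, Pi.smul_apply', map_smul, map_zero, smul_eq_mul]
  refine squeeze_zero_norm (a := fun k : ℕ => 1 / ((k : ℝ) + 1) * |a m|) (fun k => ?_) ?_
  · rw [norm_mul, Real.norm_eq_abs, Real.norm_eq_abs, abs_of_nonneg (by positivity)]
    exact mul_le_mul_of_nonneg_left (hbd k) (by positivity)
  · simpa using tendsto_one_div_add_atTop_nhds_zero_nat.mul_const (|a m|)

/-- A convex neighbourhood of `0` in `φ` contains a box `{c | ∀ n, |a n * c n| < 1}`: if it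
contains `t • δ n` for `|t| < r n`, where `δ n` are the unit vectors, then `a n = 2 ^ (n + 1) / r n`
will do, since a point of this box is a combination of such vectors with weights `2⁻ⁿ⁻¹`. -/
theorem PhiSpace.exists_box_subset {V : Set PhiSpace} (hV : V ∈ 𝓝 0) (hc : Convex ℝ V) :
    ∃ a : ℕ → ℝ, ∀ c : ℕ →₀ ℝ, (∀ n, |a n * c n| < 1) → (show PhiSpace from c) ∈ V := by
  have h1 : ∀ n : ℕ, ∃ r : ℝ, 0 < r ∧ ∀ t : ℝ, |t| < r →
      t • (show PhiSpace from Finsupp.single n (1 : ℝ)) ∈ V := by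
    intro n
    have hcont : Tendsto (fun t : ℝ => t • (show PhiSpace from Finsupp.single n (1 : ℝ)))
        (𝓝 0) (𝓝 0) := by
      have : Continuous (fun t : ℝ => t • (show PhiSpace from Finsupp.single n (1 : ℝ))) :=
        continuous_id.smul continuous_const
      have h0 := this.tendsto 0
      rwa [zero_smul ℝ (show PhiSpace from Finsupp.single n (1 : ℝ))] at h0
    obtain ⟨r, hr, h⟩ := Metric.mem_nhds_iff.1 (hcont hV)
    exact ⟨r, hr, fun t ht => h (by simpa [Metric.mem_ball] using ht)⟩
  choose r hr h using h1
  refine ⟨fun n => 2 ^ (n + 1) / r n, fun c hcn => ?_⟩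
  have hsum : (show PhiSpace from c) = ∑ n ∈ c.support, ((1 : ℝ) / 2 ^ (n + 1)) •
      ((2 ^ (n + 1) * c n) • (show PhiSpace from Finsupp.single n (1 : ℝ))) := by
    conv_lhs => rw [← Finsupp.sum_single c]
    refine Finset.sum_congr rfl fun n _ => ?_
    rw [smul_smul, ← mul_assoc, one_div, inv_mul_cancel₀ (by positivity), one_mul]
    exact (Finsupp.smul_single_one n (c n)).symm
  have hw : ∑ n ∈ c.support, (1 : ℝ) / 2 ^ (n + 1) ≤ 1 := by
    have hs := summable_geometric_two' (1 : ℝ)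
    have ht := tsum_geometric_two' (1 : ℝ)
    have h2 := hs.sum_le_tsum c.support (fun n _ => by positivity)
    rw [ht] at h2
    refine le_trans (le_of_eq (Finset.sum_congr rfl fun n _ => ?_)) h2
    rw [pow_succ]; field_simp
  have h0 : (0 : PhiSpace) ∈ V := mem_of_mem_nhds hV
  rw [hsum]
  exact hc.sum_smul_mem_of_sum_le_one h0 (fun n _ => by positivity) hw fun n _ =>
    h n _ (by
      have h3 := hcn n
      rw [div_mul_eq_mul_div, abs_div, abs_of_pos (hr n), div_lt_one (hr n)] at h3
      exact h3)

/-- If the topology of `F` is induced by a sequence of functionals which has a biorthogonal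
sequence in `F`, then the strong dual of `F` is `φ`: the polars of the sets `{a n • b n}` are the
boxes in `φ`, which form a base of neighbourhoods of `0`. -/
theorem isPhiDual_of_biorthogonal [IsTopologicalAddGroup F] [ContinuousSMul ℝ F]
    {e : ℕ → StrongDual ℝ F} {b : ℕ → F}
    (he : IsInducing fun x n => e n x) (hb : ∀ m n, e m (b n) = if m = n then 1 else 0) :
    IsPhiDual F := by
  let T : (ℕ →₀ ℝ) →ₗ[ℝ] StrongDual ℝ F := Finsupp.linearCombination ℝ e
  have hTb : ∀ c n, T c (b n) = c n := by
    intro c n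
    simp [T, Finsupp.linearCombination_apply, Finsupp.sum, hb,
      eq_comm]
  have hinj : Function.Injective T := by
    intro c d hcd
    ext n
    rw [← hTb c, hcd, hTb]
  have hsurj : Function.Surjective T := by
    intro u
    have := mem_span_of_isInducing he u
    rwa [← Finsupp.range_linearCombination] at this
  let S : PhiSpace ≃ₗ[ℝ] StrongDual ℝ F := LinearEquiv.ofBijective T ⟨hinj, hsurj⟩
  refine ⟨ContinuousLinearEquiv.symm
    { S with
      continuous_toFun := PhiSpace.continuous_linearMap (S : PhiSpace →ₗ[ℝ] StrongDual ℝ F)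
      continuous_invFun := ?_ }⟩
  change Continuous S.symm
  refine continuous_of_continuousAt_zero S.symm ?_
  rw [ContinuousAt, map_zero, (LocallyConvexSpace.convex_basis_zero ℝ PhiSpace).tendsto_right_iff]
  rintro V ⟨hV, hc⟩
  obtain ⟨a, ha⟩ := PhiSpace.exists_box_subset hV hc
  have hB := isVonNBounded_range_smul_of_biorthogonal he hb a
  have hev : ∀ᶠ u : StrongDual ℝ F in 𝓝 0,
      Set.MapsTo u (Set.range fun n => a n • b n) (Metric.ball 0 1) :=
    ContinuousLinearMap.eventually_nhds_zero_mapsTo hB (Metric.ball_mem_nhds _ one_pos)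
  filter_upwards [hev] with u hu
  refine ha (S.symm u) fun n => ?_
  have h1 := hu ⟨n, rfl⟩
  have h2 : u (b n) = (show ℕ →₀ ℝ from S.symm u) n := by
    rw [← hTb]
    exact congrArg (fun v : StrongDual ℝ F => v (b n)) (S.apply_symm_apply u).symm
  simpa [h2] using h1

end PhiDual

/-! ### Projections of `Cp Z` given by biorthogonal systems -/

section Complemented

variable {Z : Type*} [TopologicalSpace Z]

theorem Cp.isInducing_coe : IsInducing ((↑) : Cp Z → Z → ℝ) := IsInducing.subtypeVal

/-- The evaluation functional `δ_z` on `Cp Z`. -/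
def Cp.eval (z : Z) : StrongDual ℝ (Cp Z) :=
  (ContinuousLinearMap.proj z).comp (Cp Z).subtypeL

@[simp]
theorem Cp.eval_apply (z : Z) (g : Cp Z) : Cp.eval z g = (g : Z → ℝ) z := rfl

/-- A biorthogonal system `μ, f` in `Cp Z`, with `f` point-finite and with continuous sums
`∑ n, μ n g * f n`, spans a complemented subspace whose strong dual is `φ`. The projection is
`g ↦ ∑ n, μ n g • f n`. In the topology of pointwise convergence this is a convergent sum, so that
the `μ n` commute with it. -/
theorem exists_closedComplemented_isPhiDual (μ : ℕ → StrongDual ℝ (Cp Z)) (f : ℕ → Cp Z)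
    (hμf : ∀ m n, μ m (f n) = if m = n then 1 else 0)
    (hfin : ∀ z, {n | (f n : Z → ℝ) z ≠ 0}.Finite)
    (hcont : ∀ g : Cp Z, Continuous fun z => ∑ᶠ n, μ n g * (f n : Z → ℝ) z) :
    ∃ F : Submodule ℝ (Cp Z), F.ClosedComplemented ∧ IsPhiDual F := by
  have hval : ∀ (g : Cp Z) z, (∑ᶠ n, μ n g * (f n : Z → ℝ) z)
      = ∑ n ∈ (hfin z).toFinset, μ n g * (f n : Z → ℝ) z := by
    intro g z
    refine finsum_eq_sum_of_support_subset _ fun n hn => ?_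
    simp only [Function.mem_support] at hn
    simpa using right_ne_zero_of_mul hn
  let P : Cp Z →L[ℝ] Cp Z :=
    { toFun := fun g => ⟨fun z => ∑ᶠ n, μ n g * (f n : Z → ℝ) z, hcont g⟩
      map_add' := fun g h => by
        ext z
        refine (hval (g + h) z).trans ?_
        simp [hval, add_mul, Finset.sum_add_distrib]
      map_smul' := fun c g => by
        ext z
        refine (hval (c • g) z).trans ?_
        simp [hval, mul_assoc, Finset.mul_sum]
      cont := by
        refine Continuous.subtype_mk (continuous_pi fun z => ?_) _
        simp only [hval]
        fun_prop }
  have hP : ∀ g z, (P g : Z → ℝ) z = ∑ n ∈ (hfin z).toFinset, μ n g * (f n : Z → ℝ) z :=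
    fun g z => hval g z
  have hsum : ∀ g, HasSum (fun n => μ n g • f n) (P g) := by
    intro g
    rw [← IsInducing.hasSum_iff (g := (Cp Z).subtype) Cp.isInducing_coe, Pi.hasSum]
    intro z
    simp only [Submodule.subtype_apply, hP]
    refine hasSum_sum_of_ne_finset_zero fun n hn => ?_
    have : (f n : Z → ℝ) z = 0 := by simpa using hn
    simp [this]
  have hμP : ∀ m g, μ m (P g) = μ m g := by
    intro m g
    refine ((hsum g).mapL (μ m)).unique ?_
    simp only [map_smul, hμf, smul_eq_mul]
    convert hasSum_single m fun n hn => ?_ using 1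
    · simp
    · simp [hn.symm]
  have hPf : ∀ n, P (f n) = f n := by
    intro n
    refine (hsum (f n)).unique ?_
    simp only [hμf]
    have h := hasSum_single (f := fun m => (if m = n then (1 : ℝ) else 0) • f m) n
      fun m hm => by simp [hm]
    simpa using h
  have hPP : ∀ g, P (P g) = P g := by
    intro g
    ext z
    simp [hP, hμP]
  let F : Submodule ℝ (Cp Z) := LinearMap.range (P : Cp Z →ₗ[ℝ] Cp Z)
  have hPF : ∀ x : F, P x = x := by
    rintro ⟨_, g, rfl⟩
    exact hPP g
  refine ⟨F, ⟨P.codRestrict F fun g => ⟨g, rfl⟩, fun x => Subtype.ext (hPF x)⟩, ?_⟩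
  refine isPhiDual_of_biorthogonal (e := fun n => (μ n).comp F.subtypeL)
    (b := fun n => ⟨f n, f n, hPf n⟩) ?_ fun m n => hμf m n
  have hci : Continuous fun (x : F) n => ((μ n).comp F.subtypeL) x := by fun_prop
  -- The values of `x ∈ F` are recovered continuously from the numbers `μ n x`.
  have hG : Continuous fun (c : ℕ → ℝ) z => ∑ n ∈ (hfin z).toFinset, c n * (f n : Z → ℝ) z := by
    fun_prop
  refine IsInducing.of_comp hci hG ?_
  have hGe : (fun (c : ℕ → ℝ) z => ∑ n ∈ (hfin z).toFinset, c n * (f n : Z → ℝ) z) ∘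
      (fun (x : F) n => ((μ n).comp F.subtypeL) x) = fun x : F => ((x : Cp Z) : Z → ℝ) := by
    ext x z
    conv_rhs => rw [← hPF x]
    exact (hP x z).symm
  rw [hGe]
  exact Cp.isInducing_coe.comp IsInducing.subtypeVal

end Complemented

/-! ### Bumps, and spaces with an unbounded continuous function -/

theorem exists_continuous_bump {Z : Type*} [TopologicalSpace Z] [CompletelyRegularSpace Z]
    {O : Set Z} (hO : IsOpen O) {z : Z} (hz : z ∈ O) :
    ∃ f : Z → ℝ, Continuous f ∧ f z = 1 ∧ (∀ x, 0 ≤ f x) ∧ (∀ x, f x ≤ 1) ∧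
      ∀ x, f x ≠ 0 → x ∈ O := by
  obtain ⟨f, hf, hfz, hfO⟩ := CompletelyRegularSpace.completely_regular_isOpen z O hO hz
  refine ⟨fun x => 1 - f x, by fun_prop, by simp [hfz], fun x => by linarith [(f x).2.2],
    fun x => by linarith [(f x).2.1], fun x hx => ?_⟩
  by_contra hxO
  exact hx (by simp [hfO hxO])

section Unbounded

variable {Z : Type*} [TopologicalSpace Z]

/-- If `Z` carries an unbounded continuous function `g`, then `Cp Z` has a complemented copy of
`ℝ^ℕ`, spanned by bumps that live on disjoint sets `{z | a n - 1 < |g z| < a n + 1}` which form a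
locally finite family. -/
theorem exists_closedComplemented_isPhiDual_of_unbounded {g : Z → ℝ} (hg : Continuous g)
    (hunb : ∀ C, ∃ z, C < |g z|) :
    ∃ F : Submodule ℝ (Cp Z), F.ClosedComplemented ∧ IsPhiDual F := by
  choose q hq using hunb
  let z : ℕ → Z := fun n => Nat.rec (q 0) (fun _ w => q (|g w| + 2)) n
  have hz : ∀ n, |g (z n)| + 2 < |g (z (n + 1))| := fun n => hq _
  have hz' : ∀ k n : ℕ, |g (z n)| + 2 * (k : ℝ) ≤ |g (z (n + k))| := by
    intro k n
    induction k with
    | zero => simp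
    | succ k ih =>
      have := hz (n + k)
      rw [← add_assoc]
      push_cast
      linarith
  have hsep : ∀ m n, m ≠ n → 1 ≤ |(|g (z m)| - |g (z n)|)| := by
    have h1 : ∀ m n, m < n → 1 ≤ |(|g (z m)| - |g (z n)|)| := by
      intro m n hmn
      obtain ⟨k, rfl⟩ := Nat.exists_eq_add_of_lt hmn
      have := hz' (k + 1) m
      rw [abs_sub_comm]
      refine le_trans ?_ (le_abs_self _)
      push_cast at this
      rw [← add_assoc] at this
      have hk : (0 : ℝ) ≤ k := k.cast_nonneg
      linarith
    intro m n hmn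
    rcases lt_or_gt_of_ne hmn with h | h
    · exact h1 m n h
    · rw [abs_sub_comm]; exact h1 n m h
  let f : ℕ → Z → ℝ := fun n x => max 0 (1 - |(|g x| - |g (z n)|)|)
  have hf : ∀ n, Continuous (f n) := fun n => by fun_prop
  have hsupp : ∀ (n : ℕ) x, f n x ≠ 0 → 2 * (n : ℝ) < |g x| + 1 := by
    intro n x hx
    by_contra! hle
    refine hx (max_eq_left ?_)
    have h1 := hz' n 0
    rw [zero_add] at h1
    have h2 := abs_nonneg (g (z 0))
    have h3 := neg_abs_le (|g x| - |g (z n)|)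
    linarith
  have hlf : LocallyFinite fun n => Function.support (f n) := by
    intro x
    refine ⟨{y | |g y| < |g x| + 1}, (isOpen_lt hg.abs continuous_const).mem_nhds (by simp), ?_⟩
    obtain ⟨N, hN⟩ := exists_nat_gt (|g x| + 2)
    refine (Set.finite_lt_nat N).subset ?_
    rintro n ⟨y, hy, hyx⟩
    have h1 := hsupp n y hy
    have h2 : |g y| < |g x| + 1 := hyx
    have h3 : (0 : ℝ) ≤ n := n.cast_nonneg
    exact_mod_cast (by linarith : (n : ℝ) < N)
  refine exists_closedComplemented_isPhiDual (fun n => Cp.eval (z n)) (fun n => ⟨f n, hf n⟩)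
    (fun m n => ?_) (fun x => hlf.point_finite x) fun h => ?_
  · rw [Cp.eval_apply]
    change max 0 (1 - |(|g (z m)| - |g (z n)|)|) = _
    split_ifs with hmn
    · simp [hmn]
    · exact max_eq_left (by linarith [hsep m n hmn])
  · refine continuous_finsum (fun n => continuous_const.mul (hf n)) (hlf.subset fun n x hx => ?_)
    exact right_ne_zero_of_mul hx

end Unbounded

/-! ### Continuous functions on pseudocompact products -/

section Pseudocompact

/-- Pseudocompactness, written out as boundedness of all continuous functions, excludes locally
finite sequences of nonempty open sets: otherwise the sum of the bumps `n • f n` with `f n` supported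
in `O n` is continuous and unbounded. -/
theorem not_locallyFinite_of_pseudocompact {Z : Type*} [TopologicalSpace Z]
    [CompletelyRegularSpace Z]
    (hZ : ∀ g : Z → ℝ, Continuous g → ∃ C, ∀ z, |g z| ≤ C) {O : ℕ → Set Z}
    (hO : ∀ n, IsOpen (O n)) (hne : ∀ n, (O n).Nonempty) : ¬ LocallyFinite O := by
  intro hlf
  choose z hz using hne
  choose f hf hfz hf0 hf1 hfO using fun n => exists_continuous_bump (hO n) (hz n)
  have hlf' : LocallyFinite fun n : ℕ => Function.support fun x => (n : ℝ) * f n x :=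
    hlf.subset fun n x hx => hfO n x (right_ne_zero_of_mul hx)
  obtain ⟨C, hC⟩ := hZ (fun x => ∑ᶠ n : ℕ, (n : ℝ) * f n x)
    (continuous_finsum (fun n => continuous_const.mul (hf n)) hlf')
  obtain ⟨n, hn⟩ := exists_nat_gt C
  have h1 := single_le_finsum n (f := fun k : ℕ => (k : ℝ) * f k (z n))
    (hlf'.point_finite (z n)) fun k => mul_nonneg k.cast_nonneg (hf0 k _)
  have h2 := (le_abs_self _).trans (hC (z n))
  simp only [hfz, mul_one] at h1
  linarith

theorem exists_infinite_of_not_locallyFinite {ι Z : Type*} [TopologicalSpace Z] {O : ι → Set Z}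
    (h : ¬ LocallyFinite O) : ∃ z, ∀ U ∈ 𝓝 z, {n | (O n ∩ U).Nonempty}.Infinite := by
  simp only [LocallyFinite, not_forall, not_exists, not_and] at h
  exact h

variable {X Y : Type*} [TopologicalSpace X] [TopologicalSpace Y]

/-- If `X × Y` is pseudocompact, the sections `f (x, ·)` of a continuous function are equicontinuous
at each point of `Y` (Glicksberg, Frolík). Otherwise one finds open sets `U n × V n` on which
`|f (x, y) - f (x, y₀)|` is large, while it is small on `U n × V m` for `n < m`; this cannot happen
near a cluster point of the sequence `U n × V n`. -/
theorem forall_mem_nhds_abs_sub_le_of_pseudocompact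
    (hXY : ∀ O : ℕ → Set (X × Y), (∀ n, IsOpen (O n)) → (∀ n, (O n).Nonempty) → ¬ LocallyFinite O)
    {f : X × Y → ℝ} (hf : Continuous f) (y₀ : Y) {ε : ℝ} (hε : 0 < ε) :
    {y | ∀ x, |f (x, y) - f (x, y₀)| ≤ ε} ∈ 𝓝 y₀ := by
  by_contra hcon
  let g : X × Y → ℝ := fun p => |f p - f (p.1, y₀)|
  have hg : Continuous g := by fun_prop
  have hstep : ∀ W : {W : Set Y // IsOpen W ∧ y₀ ∈ W}, ∃ (U : Set X) (V : Set Y)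
      (W' : {W : Set Y // IsOpen W ∧ y₀ ∈ W}), IsOpen U ∧ IsOpen V ∧ U.Nonempty ∧ V.Nonempty ∧
      V ⊆ W ∧ W'.1 ⊆ W ∧ (∀ x ∈ U, ∀ y ∈ V, 2 * ε / 3 < g (x, y)) ∧
      ∀ x ∈ U, ∀ y ∈ W'.1, g (x, y) < ε / 3 := by
    rintro ⟨W, hW, hyW⟩
    obtain ⟨y, hy, x, hx⟩ : ∃ y ∈ W, ∃ x, ε < g (x, y) := by
      by_contra! h
      exact hcon (mem_of_superset (hW.mem_nhds hyW) fun y hy x => h y hy x)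
    have h1 : {p | 2 * ε / 3 < g p} ∈ 𝓝 (x, y) :=
      (isOpen_lt continuous_const hg).mem_nhds (by change 2 * ε / 3 < g (x, y); linarith)
    have h2 : {p | g p < ε / 3} ∈ 𝓝 (x, y₀) :=
      (isOpen_lt hg continuous_const).mem_nhds (by simp [g]; linarith)
    obtain ⟨U₁, V₁, hU₁, hxU₁, hV₁, hyV₁, h1⟩ := mem_nhds_prod_iff'.1 h1
    obtain ⟨U₂, V₂, hU₂, hxU₂, hV₂, hyV₂, h2⟩ := mem_nhds_prod_iff'.1 h2
    exact ⟨U₁ ∩ U₂, V₁ ∩ W, ⟨V₂ ∩ W, hV₂.inter hW, hyV₂, hyW⟩, hU₁.inter hU₂, hV₁.inter hW,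
      ⟨x, hxU₁, hxU₂⟩, ⟨y, hyV₁, hy⟩, Set.inter_subset_right, Set.inter_subset_right,
      fun a ha b hb => h1 ⟨ha.1, hb.1⟩, fun a ha b hb => h2 ⟨ha.2, hb.1⟩⟩
  choose U V W' hU hV hUne hVne hVW hW'W hlarge hsmall using hstep
  let W : ℕ → {W : Set Y // IsOpen W ∧ y₀ ∈ W} :=
    fun n => Nat.rec ⟨Set.univ, isOpen_univ, trivial⟩ (fun _ w => W' w) n
  have hWanti : Antitone fun n => (W n).1 := antitone_nat_of_succ_le fun n => hW'W (W n)
  obtain ⟨z, hz⟩ := exists_infinite_of_not_locallyFinite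
    (hXY (fun n => U (W n) ×ˢ V (W n)) (fun n => (hU _).prod (hV _))
      fun n => (hUne _).prod (hVne _))
  have h1 : {p | |g p - g z| < ε / 6} ∈ 𝓝 z :=
    (isOpen_lt (by fun_prop) continuous_const).mem_nhds (by simp; linarith)
  obtain ⟨G, H, hG, hzG, hH, hzH, h1⟩ := mem_nhds_prod_iff'.1 (show _ ∈ 𝓝 (z.1, z.2) from h1)
  have hinf := hz (G ×ˢ H) ((hG.prod hH).mem_nhds ⟨hzG, hzH⟩)
  obtain ⟨n, ⟨p, hpn, hp⟩⟩ := hinf.nonempty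
  obtain ⟨m, ⟨p', hpm, hp'⟩, hnm⟩ := hinf.exists_gt n
  have h2 := hlarge _ _ hpn.1 _ hpn.2
  have h3 := hsmall (W n) _ hpn.1 p'.2 (hWanti (Nat.succ_le_of_lt hnm) (hVW _ hpm.2))
  have h4 : |g (p.1, p.2) - g z| < ε / 6 := h1 hp
  have h5 : |g (p.1, p'.2) - g z| < ε / 6 := h1 (Set.mk_mem_prod hp.1 hp'.2)
  rw [abs_lt] at h4 h5
  linarith [h4.1, h4.2, h5.1, h5.2]

/-- If `X × Y` is pseudocompact, the sections `f (·, y)` of a continuous function are totally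
bounded for uniform convergence on `X`. -/
theorem exists_finset_abs_sub_le_of_pseudocompact [Nonempty X]
    (hXY : ∀ O : ℕ → Set (X × Y), (∀ n, IsOpen (O n)) → (∀ n, (O n).Nonempty) → ¬ LocallyFinite O)
    {f : X × Y → ℝ} (hf : Continuous f) {ε : ℝ} (hε : 0 < ε) :
    ∃ t : Finset Y, ∀ y, ∃ y' ∈ t, ∀ x, |f (x, y) - f (x, y')| ≤ ε := by
  by_contra! hcon
  obtain ⟨y, -, hy⟩ := exists_seq_of_forall_finset_exists (fun _ : Y => True)
    (fun y' y => ∃ x, ε < |f (x, y) - f (x, y')|) fun s _ =>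
      (hcon s).imp fun y hy => ⟨trivial, hy⟩
  have heq := fun y₀ => forall_mem_nhds_abs_sub_le_of_pseudocompact hXY hf y₀
    (show 0 < ε / 4 by positivity)
  obtain ⟨z, hz⟩ := exists_infinite_of_not_locallyFinite
    (hXY (fun n => Set.univ ×ˢ interior {y' | ∀ x, |f (x, y') - f (x, y n)| ≤ ε / 4})
      (fun n => isOpen_univ.prod isOpen_interior)
      fun n => Set.univ_nonempty.prod ⟨y n, mem_interior_iff_mem_nhds.2 (heq _)⟩)
  have hinf := hz (Set.univ ×ˢ {y' | ∀ x, |f (x, y') - f (x, z.2)| ≤ ε / 4})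
    (prod_mem_nhds univ_mem (heq z.2))
  obtain ⟨m, ⟨p, hpm, hp⟩⟩ := hinf.nonempty
  obtain ⟨n, ⟨p', hpn, hp'⟩, hmn⟩ := hinf.exists_gt m
  obtain ⟨x, hx⟩ := hy m n hmn
  have h1 := abs_le.1 (interior_subset hpm.2 x)
  have h2 := abs_le.1 (hp.2 x)
  have h3 := abs_le.1 (interior_subset hpn.2 x)
  have h4 := abs_le.1 (hp'.2 x)
  refine hx.not_ge (abs_le.2 ⟨?_, ?_⟩) <;>
    linarith [h1.1, h1.2, h2.1, h2.2, h3.1, h3.2, h4.1, h4.2]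

end Pseudocompact

/-! ### Rademacher averages -/

section Rademacher

/-- The sign `±1` encoded by a Boolean. -/
def boolSign (b : Bool) : ℝ := if b then 1 else -1

theorem boolSign_mul_self (b : Bool) : boolSign b * boolSign b = 1 := by
  cases b <;> simp [boolSign]

theorem abs_boolSign (b : Bool) : |boolSign b| = 1 := by
  cases b <;> simp [boolSign]

theorem boolSign_not (b : Bool) : boolSign (!b) = -boolSign b := by
  cases b <;> simp [boolSign]

variable {ι : Type*} [Fintype ι] [DecidableEq ι]

/-- Orthogonality of the Rademacher functions. -/
theorem sum_boolSign_mul_boolSign {i j : ι} (h : i ≠ j) :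
    ∑ s : ι → Bool, boolSign (s i) * boolSign (s j) = 0 := by
  refine Finset.sum_involution (fun s _ => Function.update s i (!s i)) (fun s _ => ?_)
    (fun s _ _ hs => ?_) (fun _ _ => Finset.mem_univ _) fun s _ => ?_
  · simp [Function.update_of_ne h.symm, boolSign_not]
  · have := congrFun hs i
    simp at this
  · simp

theorem sum_sq_sum_boolSign_mul (h : ι → ℝ) :
    ∑ s : ι → Bool, (∑ j, boolSign (s j) * h j) ^ 2 =
      2 ^ Fintype.card ι * ∑ j, h j ^ 2 := by
  have h1 : ∀ s : ι → Bool, (∑ j, boolSign (s j) * h j) ^ 2 =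
      ∑ i, ∑ j, h i * h j * (boolSign (s i) * boolSign (s j)) := by
    intro s
    rw [sq, Finset.sum_mul_sum]
    exact Finset.sum_congr rfl fun i _ => Finset.sum_congr rfl fun j _ => by ring
  simp only [h1]
  rw [Finset.sum_comm, Finset.mul_sum]
  refine Finset.sum_congr rfl fun i _ => ?_
  rw [Finset.sum_comm, Finset.sum_eq_single i]
  · simp [boolSign_mul_self]; ring
  · intro j _ hj
    rw [← Finset.mul_sum, sum_boolSign_mul_boolSign hj.symm, mul_zero]
  · simp

/-- The Rademacher averages of `G ⊗ h` are small for bounded functions `G` and `h`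
(Cauchy–Schwarz). -/
theorem abs_sum_boolSign_mul_le {G : (ι → Bool) → ℝ} {h : ι → ℝ} {A : ℝ}
    (hG : ∀ s, |G s| ≤ A) (hh : ∀ j, |h j| ≤ 1) :
    |∑ s, ∑ j, boolSign (s j) * (G s * h j)| ≤
      A * (2 ^ Fintype.card ι * √(Fintype.card ι)) := by
  have hA : 0 ≤ A := (abs_nonneg _).trans (hG fun _ => true)
  have h1 : (∑ s : ι → Bool, |∑ j, boolSign (s j) * h j|) ≤
      2 ^ Fintype.card ι * √(Fintype.card ι) := by
    refine abs_le_of_sq_le_sq' ?_ (by positivity) |>.2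
    refine sq_sum_le_card_mul_sum_sq.trans ?_
    simp only [sq_abs, sum_sq_sum_boolSign_mul]
    have h2 : ∑ j, h j ^ 2 ≤ Fintype.card ι := by
      refine (Finset.sum_le_card_nsmul _ _ 1 fun j _ => ?_).trans (by simp)
      exact (sq_le_one_iff_abs_le_one _).2 (hh j)
    rw [mul_pow, Real.sq_sqrt (Nat.cast_nonneg _), Finset.card_univ]
    simp only [Fintype.card_fun, Fintype.card_bool, Nat.cast_pow, Nat.cast_ofNat]
    rw [sq, mul_assoc]
    gcongr
  calc |∑ s, ∑ j, boolSign (s j) * (G s * h j)|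
      = |∑ s, G s * ∑ j, boolSign (s j) * h j| := by
        congr 1
        refine Finset.sum_congr rfl fun s _ => ?_
        rw [Finset.mul_sum]
        exact Finset.sum_congr rfl fun j _ => by ring
    _ ≤ ∑ s, |G s * ∑ j, boolSign (s j) * h j| := Finset.abs_sum_le_sum_abs _ _
    _ ≤ ∑ s : ι → Bool, A * |∑ j, boolSign (s j) * h j| := by
        refine Finset.sum_le_sum fun s _ => ?_
        rw [abs_mul]
        exact mul_le_mul_of_nonneg_right (hG s) (abs_nonneg _)
    _ ≤ _ := by
        rw [← Finset.mul_sum]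
        exact mul_le_mul_of_nonneg_left h1 hA

/-- The average of `φ` over `(ι → Bool) × ι`, with the sign `s j` at `(s, j)`. -/
noncomputable def signedAverage (φ : (ι → Bool) → ι → ℝ) : ℝ :=
  (2 ^ Fintype.card ι * (Fintype.card ι : ℝ))⁻¹ * ∑ s, ∑ j, boolSign (s j) * φ s j

theorem abs_signedAverage_le {φ : (ι → Bool) → ι → ℝ} {ε : ℝ} (hε : 0 ≤ ε)
    (hφ : ∀ s j, |φ s j| ≤ ε) : |signedAverage φ| ≤ ε := by
  have h1 : |∑ s, ∑ j, boolSign (s j) * φ s j| ≤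
      (2 ^ Fintype.card ι * (Fintype.card ι : ℝ)) * ε := by
    refine (Finset.abs_sum_le_sum_abs _ _).trans ?_
    refine (Finset.sum_le_card_nsmul _ _ (Fintype.card ι * ε) fun s _ => ?_).trans
      (by simp [mul_assoc])
    refine (Finset.abs_sum_le_sum_abs _ _).trans ?_
    refine (Finset.sum_le_card_nsmul _ _ ε fun j _ => ?_).trans (by simp)
    rw [abs_mul, abs_boolSign, one_mul]
    exact hφ s j
  rw [signedAverage, abs_mul, abs_inv, abs_of_nonneg (by positivity)]
  exact inv_mul_le_of_le_mul₀ (by positivity) hε h1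

theorem signedAverage_add (φ ψ : (ι → Bool) → ι → ℝ) :
    signedAverage (fun s j => φ s j + ψ s j) = signedAverage φ + signedAverage ψ := by
  simp [signedAverage, mul_add, Finset.sum_add_distrib]

theorem signedAverage_sum {κ : Type*} (t : Finset κ) (φ : κ → (ι → Bool) → ι → ℝ) :
    signedAverage (fun s j => ∑ k ∈ t, φ k s j) = ∑ k ∈ t, signedAverage (φ k) := by
  simp only [signedAverage, Finset.mul_sum]
  rw [Finset.sum_comm' (t' := Finset.univ) (s' := fun _ => t) (by simp)]
  refine Finset.sum_congr rfl fun s _ => ?_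
  rw [Finset.sum_comm]

theorem signedAverage_boolSign [Nonempty ι] :
    signedAverage (fun (s : ι → Bool) j => boolSign (s j)) = 1 := by
  simp only [signedAverage, boolSign_mul_self]
  simp [-mul_inv_rev]

theorem abs_signedAverage_mul_le {G : (ι → Bool) → ℝ} {h : ι → ℝ} {A : ℝ}
    (hG : ∀ s, |G s| ≤ A) (hh : ∀ j, |h j| ≤ 1) :
    |signedAverage fun s j => G s * h j| ≤ A / √(Fintype.card ι) := by
  have h1 := abs_sum_boolSign_mul_le hG hh
  rw [signedAverage, abs_mul, abs_inv, abs_of_nonneg (by positivity)]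
  rcases isEmpty_or_nonempty ι with hι | hι
  · simp
  · have hc : (0 : ℝ) < Fintype.card ι := by exact_mod_cast Fintype.card_pos
    refine (mul_le_mul_of_nonneg_left h1 (by positivity)).trans (le_of_eq ?_)
    have h2 : √(Fintype.card ι : ℝ) * √(Fintype.card ι : ℝ) = Fintype.card ι :=
      Real.mul_self_sqrt hc.le
    have h3 : 0 < √(Fintype.card ι : ℝ) := Real.sqrt_pos.2 hc
    field_simp
    rw [sq, h2, mul_comm]

/-- Rademacher averages of a bounded function with totally bounded sections tend to `0`, since the
function is uniformly close to a finite sum of products. -/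
theorem tendsto_signedAverage {X Y : Type*} {f : X × Y → ℝ} {C : ℝ} (hC : ∀ p, |f p| ≤ C)
    (hf : ∀ ε > 0, ∃ t : Finset Y, ∀ y, ∃ y' ∈ t, ∀ x, |f (x, y) - f (x, y')| ≤ ε)
    (x : ∀ n : ℕ, (Fin (n + 1) → Bool) → X) (y : ∀ n : ℕ, Fin (n + 1) → Y) :
    Tendsto (fun n => signedAverage fun s j => f (x n s, y n j)) atTop (𝓝 0) := by
  classical
  rw [Metric.tendsto_nhds]
  intro ε hε
  obtain ⟨t, ht⟩ := hf (ε / 2) (by positivity)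
  -- `f (x, y)` is replaced by `f (x, r y) = ∑ k ∈ t, f (x, k) * 1_{r y = k}`; the factors that
  -- depend on `y` need not be continuous.
  choose r hrt hr using ht
  have hlim : Tendsto (fun n : ℕ => (t.card : ℝ) * (C / √((n : ℝ) + 1))) atTop (𝓝 0) := by
    have h1 : Tendsto (fun n : ℕ => √((n : ℝ) + 1)) atTop atTop :=
      Real.tendsto_sqrt_atTop.comp
        (tendsto_atTop_add_const_right _ _ tendsto_natCast_atTop_atTop)
    simpa using (h1.const_div_atTop C).const_mul (t.card : ℝ)
  filter_upwards [hlim.eventually (gt_mem_nhds (show 0 < ε / 2 by positivity))] with n hn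
  have hsplit : (signedAverage fun s j => f (x n s, y n j)) =
      (signedAverage fun s j => f (x n s, y n j) - f (x n s, r (y n j))) +
      ∑ k ∈ t, signedAverage fun s j => f (x n s, k) * if r (y n j) = k then 1 else 0 := by
    rw [← signedAverage_sum, ← signedAverage_add]
    congr 1
    ext s j
    simp [hrt]
  rw [dist_zero_right, Real.norm_eq_abs, hsplit]
  have h1 := abs_signedAverage_le (φ := fun s j => f (x n s, y n j) - f (x n s, r (y n j)))
    (show 0 ≤ ε / 2 by positivity) fun s j => hr (y n j) (x n s)
  have h2 : |∑ k ∈ t, signedAverage fun s j => f (x n s, k) * if r (y n j) = k then 1 else 0| ≤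
      (t.card : ℝ) * (C / √((n : ℝ) + 1)) := by
    refine (Finset.abs_sum_le_sum_abs _ _).trans ?_
    refine (Finset.sum_le_card_nsmul _ _ (C / √((n : ℝ) + 1)) fun k _ => ?_).trans (by simp)
    have := abs_signedAverage_mul_le (G := fun s => f (x n s, k))
      (h := fun j => if r (y n j) = k then 1 else 0) (fun s => hC _)
      (fun j => by split_ifs <;> simp)
    simpa using this
  exact (abs_add_le _ _).trans_lt (by linarith)

end Rademacher

/-! ### Functions with disjoint supports -/

section Disjoint

/-- A null sequence times a bounded sequence of continuous functions with disjoint supports has a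
continuous sum, because the partial sums converge uniformly. -/
theorem continuous_finsum_of_disjoint_support {Z : Type*} [TopologicalSpace Z] {f : ℕ → Z → ℝ}
    (hf : ∀ n, Continuous (f n)) (hf1 : ∀ n z, |f n z| ≤ 1)
    (hdisj : ∀ z m n, f m z ≠ 0 → f n z ≠ 0 → m = n) {c : ℕ → ℝ} (hc : Tendsto c atTop (𝓝 0)) :
    Continuous fun z => ∑ᶠ n, c n * f n z := by
  refine continuous_of_uniform_approx_of_continuous fun U hU => ?_
  obtain ⟨ε, hε, hεU⟩ := Metric.mem_uniformity_dist.1 hU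
  obtain ⟨N, hN⟩ := Metric.tendsto_atTop.1 hc ε hε
  refine ⟨fun z => ∑ n ∈ Finset.range N, c n * f n z, by fun_prop, fun z => hεU ?_⟩
  by_cases hz : ∃ m, f m z ≠ 0
  · obtain ⟨m, hm⟩ := hz
    have h0 : ∀ n, n ≠ m → c n * f n z = 0 := fun n hn => by
      rw [mul_eq_zero]
      right
      by_contra h
      exact hn (hdisj z n m h hm)
    rw [finsum_eq_single _ m h0]
    beta_reduce
    by_cases hmN : m < N
    · rw [Finset.sum_eq_single m (fun n _ => h0 n) (by simp [hmN])]
      simpa using hε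
    · rw [Finset.sum_eq_zero fun n hn => h0 n (by have := Finset.mem_range.1 hn; omega),
        dist_zero_right, norm_mul]
      have h1 := hN m (not_lt.1 hmN)
      rw [dist_zero_right] at h1
      calc ‖c m‖ * ‖f m z‖ ≤ ‖c m‖ * 1 := by gcongr; exact hf1 m z
        _ < ε := by simpa using h1
  · push Not at hz
    simpa [hz] using hε

theorem sum_le_one_of_disjoint_support {ι : Type*} {a : ι → ℝ} (ha1 : ∀ i, a i ≤ 1)
    (hdisj : ∀ i j, a i ≠ 0 → a j ≠ 0 → i = j) (t : Finset ι) : ∑ i ∈ t, a i ≤ 1 := by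
  by_cases h : ∃ i ∈ t, a i ≠ 0
  · obtain ⟨i, hi, hai⟩ := h
    rw [Finset.sum_eq_single i (fun j _ hj => ?_) (by simp [hi])]
    · exact ha1 i
    · by_contra h
      exact hj (hdisj j i h hai)
  · push Not at h
    rw [Finset.sum_eq_zero h]
    exact zero_le_one

theorem exists_biorthogonal_bumps (X : Type*) [TopologicalSpace X] [T35Space X] [Infinite X] :
    ∃ (x : ℕ → X) (u : ℕ → X → ℝ), (∀ n, Continuous (u n)) ∧
      (∀ n z, 0 ≤ u n z) ∧ (∀ n z, u n z ≤ 1) ∧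
      (∀ z m n, u m z ≠ 0 → u n z ≠ 0 → m = n) ∧
      ∀ m n, u m (x n) = if m = n then 1 else 0 := by
  obtain ⟨U, hUi, hUo, hd⟩ := exists_seq_infinite_isOpen_pairwise_disjoint X
  choose x hx using fun n => (hUi n).nonempty
  choose u hu hux hu0 hu1 hun using fun n => exists_continuous_bump (hUo n) (hx n)
  have hdisj : ∀ z m n, u m z ≠ 0 → u n z ≠ 0 → m = n := by
    intro z m n hm hn
    by_contra hmn
    exact Set.disjoint_left.1 (hd hmn) (hun m z hm) (hun n z hn)
  refine ⟨x, u, hu, hu0, hu1, hdisj, fun m n => ?_⟩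
  split_ifs with h
  · rw [h, hux]
  · by_contra hne
    exact h (hdisj (x n) m n hne (by rw [hux]; exact one_ne_zero))

end Disjoint

/-! ### Products -/

section Product

variable {X Y : Type*} [TopologicalSpace X] [TopologicalSpace Y]

/-- The finitely supported signed measure that averages functions on a grid `x s, y j` with
Rademacher signs, as a functional on `Cp (X × Y)`. -/
noncomputable def Cp.signedAverage {ι : Type*} [Fintype ι] [DecidableEq ι] (x : (ι → Bool) → X)
    (y : ι → Y) : StrongDual ℝ (Cp (X × Y)) :=
  (2 ^ Fintype.card ι * (Fintype.card ι : ℝ))⁻¹ •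
    ∑ s, ∑ j, boolSign (s j) • Cp.eval (x s, y j)

theorem Cp.signedAverage_apply {ι : Type*} [Fintype ι] [DecidableEq ι] (x : (ι → Bool) → X)
    (y : ι → Y) (g : Cp (X × Y)) :
    Cp.signedAverage x y g = _root_.signedAverage fun s j => (g : X × Y → ℝ) (x s, y j) := by
  simp [Cp.signedAverage, _root_.signedAverage]

/-- If `X × Y` is pseudocompact, then `Cp (X × Y)` has a complemented copy of `c₀`, spanned by
functions `∑ s, ∑ j, ± u s ⊗ v j` on disjoint grids. -/
theorem exists_closedComplemented_isPhiDual_of_pseudocompact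
    [T35Space X] [T35Space Y] [Infinite X] [Infinite Y]
    (hZ : ∀ g : X × Y → ℝ, Continuous g → ∃ C, ∀ z, |g z| ≤ C) :
    ∃ F : Submodule ℝ (Cp (X × Y)), F.ClosedComplemented ∧ IsPhiDual F := by
  obtain ⟨x, u, hu, hu0, hu1, hud, hux⟩ := exists_biorthogonal_bumps X
  obtain ⟨y, v, hv, hv0, hv1, hvd, hvy⟩ := exists_biorthogonal_bumps Y
  -- The sign vectors of all lengths index the points of `X`, so that the grids for different `n`
  -- have disjoint projections to `X`; the points of `Y` are used again for each `n`.
  let e : ∀ n : ℕ, (Fin (n + 1) → Bool) → ℕ := fun n s =>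
    Encodable.encode (⟨n, s⟩ : Σ n : ℕ, (Fin (n + 1) → Bool))
  have he : ∀ m s n s', e m s = e n s' →
      (⟨m, s⟩ : Σ n : ℕ, (Fin (n + 1) → Bool)) = ⟨n, s'⟩ := fun m s n s' h =>
    Encodable.encode_injective h
  have he' : ∀ n s s', e n s = e n s' → s = s' := fun n s s' h => by
    simpa using he n s n s' h
  let f : ℕ → X × Y → ℝ := fun n p =>
    ∑ s : Fin (n + 1) → Bool, ∑ j : Fin (n + 1), boolSign (s j) * (u (e n s) p.1 * v j p.2)
  have hf : ∀ n, Continuous (f n) := fun n => by fun_prop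
  have hf1 : ∀ n z, |f n z| ≤ 1 := by
    intro n z
    calc |f n z| ≤ ∑ s : Fin (n + 1) → Bool, ∑ j : Fin (n + 1), u (e n s) z.1 * v j z.2 := by
          refine (Finset.abs_sum_le_sum_abs _ _).trans (Finset.sum_le_sum fun s _ => ?_)
          refine (Finset.abs_sum_le_sum_abs _ _).trans (Finset.sum_le_sum fun j _ => ?_)
          rw [abs_mul, abs_boolSign, one_mul, abs_of_nonneg (mul_nonneg (hu0 _ _) (hv0 _ _))]
      _ = (∑ s : Fin (n + 1) → Bool, u (e n s) z.1) * ∑ j : Fin (n + 1), v j z.2 :=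
          (Finset.sum_mul_sum _ _ _ _).symm
      _ ≤ 1 := by
          refine mul_le_one₀ ?_ (Finset.sum_nonneg fun j _ => hv0 _ _) ?_
          · exact sum_le_one_of_disjoint_support (fun s => hu1 _ _)
              (fun s s' h h' => he' n s s' (hud z.1 _ _ h h')) _
          · exact sum_le_one_of_disjoint_support (fun s => hv1 _ _)
              (fun i j h h' => Fin.ext (hvd z.2 _ _ h h')) _
  have hfu : ∀ n z, f n z ≠ 0 → ∃ s, u (e n s) z.1 ≠ 0 := by
    intro n z h
    by_contra! h0
    exact h (Finset.sum_eq_zero fun s _ => Finset.sum_eq_zero fun j _ => by simp [h0])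
  have hdisj : ∀ z m n, f m z ≠ 0 → f n z ≠ 0 → m = n := by
    intro z m n hm hn
    obtain ⟨s, hs⟩ := hfu m z hm
    obtain ⟨s', hs'⟩ := hfu n z hn
    exact congrArg Sigma.fst (he m s n s' (hud z.1 _ _ hs hs'))
  have hfxy : ∀ n s (j : Fin (n + 1)), f n (x (e n s), y j) = boolSign (s j) := by
    intro n s j
    simp only [f, hux, hvy]
    rw [Finset.sum_eq_single s, Finset.sum_eq_single j]
    · simp
    · intro i _ hi
      simp [Fin.val_inj, hi]
    · simp
    · intro s' _ hs'
      have : e n s' ≠ e n s := fun h => hs' (he' n _ _ h)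
      simp [this]
    · simp
  have hcl : ∀ O : ℕ → Set (X × Y), (∀ n, IsOpen (O n)) → (∀ n, (O n).Nonempty) →
      ¬ LocallyFinite O := fun O hO hne => not_locallyFinite_of_pseudocompact hZ hO hne
  refine exists_closedComplemented_isPhiDual
    (fun n => Cp.signedAverage (fun s => x (e n s)) fun j : Fin (n + 1) => y j)
    (fun n => ⟨f n, hf n⟩) (fun m n => ?_) (fun z => ?_) fun g => ?_
  · rw [Cp.signedAverage_apply]
    split_ifs with hmn
    · subst hmn
      simp only [hfxy]
      exact signedAverage_boolSign
    · have h0 : ∀ s (j : Fin (m + 1)), f n (x (e m s), y j) = 0 := by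
        intro s j
        by_contra h
        refine hmn (hdisj _ m n ?_ h)
        rw [hfxy]
        exact abs_pos.1 (by rw [abs_boolSign]; exact one_pos)
      simp [h0, signedAverage]
  · exact Set.Subsingleton.finite fun m hm n hn => hdisj z m n hm hn
  · refine continuous_finsum_of_disjoint_support hf hf1 hdisj ?_
    obtain ⟨C, hC⟩ := hZ g g.2
    simp only [Cp.signedAverage_apply]
    exact tendsto_signedAverage hC
      (fun ε hε => exists_finset_abs_sub_le_of_pseudocompact hcl g.2 hε) _ _

end Product

theorem corollary2p8 {X Y : Type*} [TopologicalSpace X] [TopologicalSpace Y]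
    [T35Space X] [T35Space Y] [Infinite X] [Infinite Y] :
    ∃ F : Submodule ℝ (Cp (X × Y)), F.ClosedComplemented ∧ IsPhiDual F := by
  by_cases hZ : ∀ g : X × Y → ℝ, Continuous g → ∃ C, ∀ z, |g z| ≤ C
  · exact exists_closedComplemented_isPhiDual_of_pseudocompact hZ
  · push Not at hZ
    obtain ⟨g, hg, hunb⟩ := hZ
    exact exists_closedComplemented_isPhiDual_of_unbounded hg hunb
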